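/- Let $\mathbf{FdHilb}$ be the category of finite-dimensional complex Hilbert spaces and linear maps, with the symmetric monoidal structure given by the orthogonal direct sum $\oplus$ (unit $\{0\}$). Let $\mathbf{FdContraction}$, $\mathbf{FdIsometry}$, $\mathbf{FdUnitary}$ be its symmetric monoidal subcategories with the same objects and with morphisms the linear maps $f$ satisfying, respectively, $\|f(a)\|\le\|a\|$ for all $a$; $\|f(a)\|=\|a\|$ for all $a$; and $f$ a surjective isometry. For $f\colon A\oplus U\to B\oplus U$ with matrix components $f_{BA},f_{BU},f_{UA},f_{UU}$, the execution formula is the partial operation $$\mathrm{ex}^U(f)=\Sigma\bigl(\{f_{BA}\}\uplus\{f_{BU}\,f_{UU}^{\,n}\,f_{UA}\}_{n\in\mathbb N}\bigr)\colon A\to B,$$ where $\Sigma$ of a family of linear maps is the limit, in the operator norm, of the net of its finite partial sums, and is undefined if this limit does not exist; in $\mathbf{FdContraction}$ it is moreover required that the limit be a contraction. For a morphism $f\colon A\oplus U\to B\oplus U$ of $\mathbf{FdIsometry}$ (respectively $\mathbf{FdUnitary}$), let $\widehat{\mathrm{ex}}^U(f)=\mathrm{ex}^U(f)$ (computed in $\mathbf{FdContraction}$)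 if this is defined and is an isometry (respectively unitary), and let $\widehat{\mathrm{ex}}^U(f)$ be undefined otherwise. A family of partial maps $T^U_{A,B}\colon \mathcal C(A\otimes U,B\otimes U)\rightharpoonup\mathcal C(A,B)$ on a symmetric monoidal category $(\mathcal C,\otimes,I)$ is a total trace if every $T^U_{A,B}$ is defined everywhere and, suppressing associators: - (naturality) $h\circ T^U(f)\circ g=T^U((h\otimes\mathrm{id}_U)\circ f\circ(g\otimes\mathrm{id}_U))$ for $f\colon A\otimes U\to B\otimes U$, $g\colon A'\to A$, $h\colon B\to B'$; - (dinaturality) $T^U((\mathrm{id}_B\otimes g)\circ f)=T^{U'}(f\circ(\mathrm{id}_A\otimes g))$ for $f\colon A\otimes U\to B\otimes U'$, $g\colon U'\to U$; - (superposing) $g\otimes T^U(f)=T^U(g\otimes f)$ for $f\colon A\otimes U\to B\otimes U$, $g\colon C\to D$; - (vanishing I) $T^I(f)=\rho_B\circ f\circ\rho_A^{-1}$ for $f\colon A\otimes I\to B\otimes I$; - (vanishing II) $T^U(T^V(f))=T^{U\otimes V}(f)$ for $f\colon A\otimes U\otimes V\to B\otimes U\otimes V$; - (yanking) $T^U(\sigma_{U,U})=\mathrm{id}_U$,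 where $\sigma$ is the symmetry. Then $(\mathbf{FdIsometry},\oplus,\widehat{\mathrm{ex}})$ is totally traced, that is, $\widehat{\mathrm{ex}}$ is a total trace on $\mathbf{FdIsometry}$ (in particular $\mathrm{ex}^U(f)$ is defined and is an isometry for every isometry $f\colon A\oplus U\to B\oplus U$). Similarly, $(\mathbf{FdUnitary},\oplus,\widehat{\mathrm{ex}})$ is totally traced (in particular $\mathrm{ex}^U(f)$ is defined and is unitary for every unitary $f\colon A\oplus U\to B\oplus U$). -/

import Mathlib

open CategoryTheory MonoidalCategory

universe u v w

/-! ### Traces on symmetric monoidal categories -/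

section Traced

variable {C : Type w} [Category.{v} C] [MonoidalCategory C]

/-- A family of total maps `Tr : C(A ⊗ U, B ⊗ U) → C(A, B)` is a trace, that is, makes the symmetric
monoidal category `C` a traced monoidal category (axioms of Joyal, Street and Verity). Composition
is written in diagrammatic order. -/
structure IsTrace [SymmetricCategory C]
    (Tr : ∀ {A B U : C}, (A ⊗ U ⟶ B ⊗ U) → (A ⟶ B)) : Prop where
  naturality : ∀ {A A' B B' U : C} (f : A ⊗ U ⟶ B ⊗ U) (g : A' ⟶ A) (h : B ⟶ B'),
    g ≫ Tr f ≫ h = Tr ((g ⊗ₘ 𝟙 U) ≫ f ≫ (h ⊗ₘ 𝟙 U))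
  dinaturality : ∀ {A B U U' : C} (f : A ⊗ U ⟶ B ⊗ U') (g : U' ⟶ U),
    Tr (f ≫ (𝟙 B ⊗ₘ g)) = Tr ((𝟙 A ⊗ₘ g) ≫ f)
  superposing : ∀ {A B C' D U : C} (f : A ⊗ U ⟶ B ⊗ U) (g : C' ⟶ D),
    g ⊗ₘ Tr f = Tr ((α_ C' A U).hom ≫ (g ⊗ₘ f) ≫ (α_ D B U).inv)
  vanishing_one : ∀ {A B : C} (f : A ⊗ 𝟙_ C ⟶ B ⊗ 𝟙_ C),
    Tr f = (ρ_ A).inv ≫ f ≫ (ρ_ B).hom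
  vanishing_two : ∀ {A B U V : C} (f : A ⊗ (U ⊗ V) ⟶ B ⊗ (U ⊗ V)),
    Tr (Tr ((α_ A U V).hom ≫ f ≫ (α_ B U V).inv)) = Tr f
  yanking : ∀ U : C, Tr (β_ U U).hom = 𝟙 U

/-- A family of partial maps `T : C(A ⊗ U, B ⊗ U) ⇀ C(A, B)` makes `C` totally traced: every
`T f` is defined, and the resulting family of total maps is a trace. -/
def IsTotallyTraced (C : Type w) [Category.{v} C] [MonoidalCategory C] [SymmetricCategory C]
    (T : ∀ {A B U : C}, (A ⊗ U ⟶ B ⊗ U) → Part (A ⟶ B)) : Prop :=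
  ∃ Tr : ∀ {A B U : C}, (A ⊗ U ⟶ B ⊗ U) → (A ⟶ B),
    IsTrace Tr ∧ ∀ {A B U : C} (f : A ⊗ U ⟶ B ⊗ U), T f = Part.some (Tr f)

end Traced

/-- Restriction of a partially defined morphism along a faithful functor `F`: its value is the unique
`g` such that `F.map g` is the value of `t`, and it is undefined if there is no such `g`. -/
noncomputable def restrictPart {C : Type*} {D : Type*} [Category* C] [Category* D] (F : D ⥤ C)
    [F.Faithful] {X Y : D} (t : Part (F.obj X ⟶ F.obj Y)) : Part (X ⟶ Y) :=
  ⟨∃ g : X ⟶ Y, F.map g ∈ t, fun h => h.choose⟩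

theorem mem_restrictPart {C : Type*} {D : Type*} [Category* C] [Category* D] (F : D ⥤ C)
    [F.Faithful] {X Y : D} (t : Part (F.obj X ⟶ F.obj Y)) (g : X ⟶ Y) :
    g ∈ restrictPart F t ↔ F.map g ∈ t := by
  constructor
  · rintro ⟨h, rfl⟩
    exact h.choose_spec
  · intro hg
    have h : ∃ g : X ⟶ Y, F.map g ∈ t := ⟨g, hg⟩
    exact ⟨h, F.map_injective (Part.mem_unique h.choose_spec hg)⟩

/-- The inclusion of a wide subcategory into a larger one. -/
def wideInclusionOfLE {C : Type*} [Category* C] {P Q : MorphismProperty C} [P.IsMultiplicative]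
    [Q.IsMultiplicative] (h : P ≤ Q) : WideSubcategory P ⥤ WideSubcategory Q where
  obj X := ⟨X.obj⟩
  map f := ⟨f.hom, h _ f.property⟩

instance {C : Type*} [Category* C] {P Q : MorphismProperty C} [P.IsMultiplicative]
    [Q.IsMultiplicative] (h : P ≤ Q) : (wideInclusionOfLE h).Faithful where
  map_injective {X Y f g} e := by
    have e' : ((wideInclusionOfLE h).map f).hom = ((wideInclusionOfLE h).map g).hom := by rw [e]
    exact WideSubcategory.hom_ext P e'

/-! ### Finite-dimensional Hilbert spaces with the orthogonal direct sum -/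

/-- A finite-dimensional complex Hilbert space. -/
structure FdHilb : Type (u + 1) where
  carrier : Type u
  [normedAddCommGroup : NormedAddCommGroup carrier]
  [innerProductSpace : InnerProductSpace ℂ carrier]
  [finiteDimensional : FiniteDimensional ℂ carrier]

namespace FdHilb

attribute [instance] normedAddCommGroup innerProductSpace finiteDimensional

instance : CoeSort FdHilb.{u} (Type u) := ⟨carrier⟩

/-- Morphisms are (bounded) linear maps. -/
@[ext]
structure Hom (A B : FdHilb.{u}) where
  toCLM : A →L[ℂ] B

instance : Category FdHilb.{u} where
  Hom := Hom
  id A := ⟨ContinuousLinearMap.id ℂ A⟩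
  comp f g := ⟨g.toCLM ∘L f.toCLM⟩

@[ext]
theorem hom_ext {A B : FdHilb.{u}} {f g : A ⟶ B} (h : ∀ a, f.toCLM a = g.toCLM a) : f = g :=
  Hom.ext (ContinuousLinearMap.ext h)

@[simp]
theorem id_apply {A : FdHilb.{u}} (a : A) : (𝟙 A : A ⟶ A).toCLM a = a := rfl

@[simp]
theorem comp_apply {A B C : FdHilb.{u}} (f : A ⟶ B) (g : B ⟶ C) (a : A) :
    (f ≫ g).toCLM a = g.toCLM (f.toCLM a) := rfl

/-- The isomorphism given by a linear isometric equivalence. -/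
def isoOfLIE {A B : FdHilb.{u}} (e : A ≃ₗᵢ[ℂ] B) : A ≅ B where
  hom := ⟨(e.toContinuousLinearEquiv : A →L[ℂ] B)⟩
  inv := ⟨(e.symm.toContinuousLinearEquiv : B →L[ℂ] A)⟩
  hom_inv_id := hom_ext fun a => e.symm_apply_apply a
  inv_hom_id := hom_ext fun b => e.apply_symm_apply b

@[simp]
theorem isoOfLIE_hom_apply {A B : FdHilb.{u}} (e : A ≃ₗᵢ[ℂ] B) (a : A) :
    (isoOfLIE e).hom.toCLM a = e a := rfl

@[simp]
theorem isoOfLIE_inv_apply {A B : FdHilb.{u}} (e : A ≃ₗᵢ[ℂ] B) (b : B) :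
    (isoOfLIE e).inv.toCLM b = e.symm b := rfl

/-- The direct sum, with inner product `⟪(a, b), (a', b')⟫ = ⟪a, a'⟫ + ⟪b, b'⟫`. -/
noncomputable abbrev dsum (A B : FdHilb.{u}) : FdHilb.{u} := ⟨WithLp 2 (A × B)⟩

/-- The linear map `(a, b) ↦ (f a, g b)`. -/
noncomputable def dsumMap {A B C D : FdHilb.{u}} (f : A ⟶ C) (g : B ⟶ D) : dsum A B ⟶ dsum C D :=
  ⟨LinearMap.toContinuousLinearMap
    ((f.toCLM.toLinearMap.prodMap g.toCLM.toLinearMap).withLpMap 2)⟩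

noncomputable instance : MonoidalCategoryStruct FdHilb.{u} where
  tensorObj A B := dsum A B
  whiskerLeft A _ _ g := dsumMap (𝟙 A) g
  whiskerRight f B := dsumMap f (𝟙 B)
  tensorHom f g := dsumMap f g
  tensorUnit := ⟨PUnit.{u + 1}⟩
  associator A B C :=
    isoOfLIE (A := dsum (dsum A B) C) (B := dsum A (dsum B C))
      (LinearIsometryEquiv.withLpProdAssoc 2 ℂ A B C)
  leftUnitor A :=
    isoOfLIE (A := dsum ⟨PUnit.{u + 1}⟩ A) (B := A)
      (LinearIsometryEquiv.withLpUniqueProd 2 ℂ (PUnit.{u + 1}) A)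
  rightUnitor A :=
    isoOfLIE (A := dsum A ⟨PUnit.{u + 1}⟩) (B := A)
      (LinearIsometryEquiv.withLpProdUnique 2 ℂ A (PUnit.{u + 1}))

noncomputable instance : MonoidalCategory FdHilb.{u} :=
  MonoidalCategory.ofTensorHom
    (id_tensorHom_id := fun _ _ => hom_ext fun _ => rfl)
    (id_tensorHom := fun _ _ _ _ => hom_ext fun _ => rfl)
    (tensorHom_id := fun _ _ => hom_ext fun _ => rfl)
    (tensorHom_comp_tensorHom := fun _ _ _ _ => hom_ext fun _ => rfl)
    (associator_naturality := fun _ _ _ => hom_ext fun _ => rfl)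
    (leftUnitor_naturality := fun _ => hom_ext fun _ => rfl)
    (rightUnitor_naturality := fun _ => hom_ext fun _ => rfl)
    (pentagon := fun _ _ _ _ => hom_ext fun _ => rfl)
    (triangle := fun _ _ => hom_ext fun _ => rfl)

noncomputable instance : BraidedCategory FdHilb.{u} where
  braiding A B :=
    isoOfLIE (A := dsum A B) (B := dsum B A) (LinearIsometryEquiv.withLpProdComm 2 ℂ A B)
  braiding_naturality_left _ _ := hom_ext fun _ => rfl
  braiding_naturality_right _ _ _ _ := hom_ext fun _ => rfl
  hexagon_forward _ _ _ := hom_ext fun _ => rfl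
  hexagon_reverse _ _ _ := hom_ext fun _ => rfl

noncomputable instance : SymmetricCategory FdHilb.{u} where
  symmetry _ _ := hom_ext fun _ => rfl

/-! ### The execution formula -/

/-- The injection `A → A ⊕ B`. -/
noncomputable def inl (A B : FdHilb.{u}) : A ⟶ A ⊗ B :=
  ⟨LinearMap.toContinuousLinearMap
    ((WithLp.linearEquiv 2 ℂ (A × B)).symm.toLinearMap ∘ₗ LinearMap.inl ℂ A B)⟩

/-- The injection `B → A ⊕ B`. -/
noncomputable def inr (A B : FdHilb.{u}) : B ⟶ A ⊗ B :=
  ⟨LinearMap.toContinuousLinearMap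
    ((WithLp.linearEquiv 2 ℂ (A × B)).symm.toLinearMap ∘ₗ LinearMap.inr ℂ A B)⟩

/-- The projection `A ⊕ B → A`. -/
noncomputable def fst (A B : FdHilb.{u}) : A ⊗ B ⟶ A := ⟨WithLp.fstL 2 ℂ A B⟩

/-- The projection `A ⊕ B → B`. -/
noncomputable def snd (A B : FdHilb.{u}) : A ⊗ B ⟶ B := ⟨WithLp.sndL 2 ℂ A B⟩

/-- The family `{f_BA} ⊎ {f_BU f_UU ^ n f_UA}_{n ∈ ℕ}` of the paths of `f : A ⊕ U → B ⊕ U`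
from `A` to `B`. -/
noncomputable def paths {A B U : FdHilb.{u}} (f : A ⊗ U ⟶ B ⊗ U) : Unit ⊕ ℕ → (A →L[ℂ] B) :=
  Sum.elim (fun _ => (inl A U ≫ f ≫ fst B U).toCLM)
    (fun n => (inr A U ≫ f ≫ fst B U).toCLM ∘L ((inr A U ≫ f ≫ snd B U).toCLM ^ n) ∘L
      (inl A U ≫ f ≫ snd B U).toCLM)

/-- The execution formula `ex^U(f) = Σ ({f_BA} ⊎ {f_BU f_UU ^ n f_UA}_{n ∈ ℕ})` in `FdHilb`. It is
defined when the net of all finite partial sums converges in operator norm. -/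
noncomputable def ex {A B U : FdHilb.{u}} (f : A ⊗ U ⟶ B ⊗ U) : Part (A ⟶ B) :=
  ⟨Summable (paths f), fun _ => ⟨∑' i, paths f i⟩⟩

/-! ### Contractions, isometries and unitaries -/

/-- Contractions. -/
def contractions : MorphismProperty FdHilb.{u} := fun _ _ f => ∀ a, ‖f.toCLM a‖ ≤ ‖a‖

/-- Isometries. -/
def isometries : MorphismProperty FdHilb.{u} := fun _ _ f => ∀ a, ‖f.toCLM a‖ = ‖a‖

/-- Unitaries, that is, surjective isometries. -/
def unitaries : MorphismProperty FdHilb.{u} := fun _ _ f =>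
  (∀ a, ‖f.toCLM a‖ = ‖a‖) ∧ Function.Surjective f.toCLM

theorem unitaries_le_isometries : unitaries.{u} ≤ isometries := fun _ _ _ h => h.1

theorem isometries_le_contractions : isometries.{u} ≤ contractions := fun _ _ _ h a => (h a).le

theorem unitaries_le_contractions : unitaries.{u} ≤ contractions :=
  unitaries_le_isometries.trans isometries_le_contractions

theorem isoOfLIE_hom_mem {A B : FdHilb.{u}} (e : A ≃ₗᵢ[ℂ] B) : unitaries (isoOfLIE e).hom :=
  ⟨e.norm_map, e.surjective⟩

theorem isoOfLIE_inv_mem {A B : FdHilb.{u}} (e : A ≃ₗᵢ[ℂ] B) : unitaries (isoOfLIE e).inv :=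
  ⟨e.symm.norm_map, e.symm.surjective⟩

theorem norm_sq_dsum {A B : FdHilb.{u}} (x : dsum A B) : ‖x‖ ^ 2 = ‖x.fst‖ ^ 2 + ‖x.snd‖ ^ 2 :=
  WithLp.prod_norm_sq_eq_of_L2 x

/-- A multiplicative property of morphisms that contains all unitaries and is closed under direct
sums defines a symmetric monoidal wide subcategory. -/
theorem isStableUnderBraiding_of_unitaries_le {P : MorphismProperty FdHilb.{u}} [P.IsMultiplicative]
    (hP : unitaries ≤ P)
    (h : ∀ {A B C D : FdHilb.{u}} (f : A ⟶ C) (g : B ⟶ D), P f → P g → P (f ⊗ₘ g)) :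
    P.IsStableUnderBraiding where
  toIsMonoidal := MorphismProperty.IsMonoidal.mk' _ h
  associator_hom_mem _ _ _ := hP _ (isoOfLIE_hom_mem _)
  associator_inv_mem _ _ _ := hP _ (isoOfLIE_inv_mem _)
  leftUnitor_hom_mem _ := hP _ (isoOfLIE_hom_mem _)
  leftUnitor_inv_mem _ := hP _ (isoOfLIE_inv_mem _)
  rightUnitor_hom_mem _ := hP _ (isoOfLIE_hom_mem _)
  rightUnitor_inv_mem _ := hP _ (isoOfLIE_inv_mem _)
  braiding_hom_mem _ _ := hP _ (isoOfLIE_hom_mem _)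
  braiding_inv_mem _ _ := hP _ (isoOfLIE_inv_mem _)

instance : contractions.{u}.IsMultiplicative where
  id_mem _ _ := le_rfl
  comp_mem _ _ hf hg a := (hg _).trans (hf a)

instance : isometries.{u}.IsMultiplicative where
  id_mem _ _ := rfl
  comp_mem _ _ hf hg a := (hg _).trans (hf a)

instance : unitaries.{u}.IsMultiplicative where
  id_mem _ := ⟨fun _ => rfl, Function.surjective_id⟩
  comp_mem _ _ hf hg := ⟨fun a => (hg.1 _).trans (hf.1 a), hg.2.comp hf.2⟩

theorem contractions_tensorHom {A B C D : FdHilb.{u}} (f : A ⟶ C) (g : B ⟶ D)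
    (hf : contractions f) (hg : contractions g) : contractions (f ⊗ₘ g) := by
  intro (x : dsum A B)
  have h1 : ‖(f ⊗ₘ g).toCLM x‖ ^ 2 = ‖f.toCLM x.fst‖ ^ 2 + ‖g.toCLM x.snd‖ ^ 2 :=
    norm_sq_dsum (A := C) (B := D) _
  have h2 : ‖x‖ ^ 2 = ‖x.fst‖ ^ 2 + ‖x.snd‖ ^ 2 := norm_sq_dsum x
  have h3 := pow_le_pow_left₀ (norm_nonneg _) (hf x.fst) 2
  have h4 := pow_le_pow_left₀ (norm_nonneg _) (hg x.snd) 2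
  exact le_of_sq_le_sq (by linarith) (norm_nonneg _)

theorem isometries_tensorHom {A B C D : FdHilb.{u}} (f : A ⟶ C) (g : B ⟶ D)
    (hf : isometries f) (hg : isometries g) : isometries (f ⊗ₘ g) := by
  intro (x : dsum A B)
  have h1 : ‖(f ⊗ₘ g).toCLM x‖ ^ 2 = ‖f.toCLM x.fst‖ ^ 2 + ‖g.toCLM x.snd‖ ^ 2 :=
    norm_sq_dsum (A := C) (B := D) _
  have h2 : ‖x‖ ^ 2 = ‖x.fst‖ ^ 2 + ‖x.snd‖ ^ 2 := norm_sq_dsum x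
  rw [hf, hg, ← h2] at h1
  exact (sq_eq_sq₀ (norm_nonneg _) (norm_nonneg _)).1 h1

theorem unitaries_tensorHom {A B C D : FdHilb.{u}} (f : A ⟶ C) (g : B ⟶ D)
    (hf : unitaries f) (hg : unitaries g) : unitaries (f ⊗ₘ g) := by
  refine ⟨isometries_tensorHom f g hf.1 hg.1, fun (y : dsum C D) => ?_⟩
  obtain ⟨a, ha⟩ := hf.2 y.fst
  obtain ⟨b, hb⟩ := hg.2 y.snd
  refine ⟨(WithLp.toLp 2 (a, b) : dsum A B), ?_⟩
  change WithLp.toLp 2 (f.toCLM a, g.toCLM b) = y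
  rw [ha, hb]
  rfl

instance : contractions.{u}.IsStableUnderBraiding :=
  isStableUnderBraiding_of_unitaries_le unitaries_le_contractions contractions_tensorHom

instance : isometries.{u}.IsStableUnderBraiding :=
  isStableUnderBraiding_of_unitaries_le unitaries_le_isometries isometries_tensorHom

instance : unitaries.{u}.IsStableUnderBraiding :=
  isStableUnderBraiding_of_unitaries_le le_rfl unitaries_tensorHom

end FdHilb

/-- Finite-dimensional Hilbert spaces and contractions. -/
abbrev FdContraction : Type (u + 1) := WideSubcategory FdHilb.contractions.{u}

/-- Finite-dimensional Hilbert spaces and isometries. -/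
abbrev FdIsometry : Type (u + 1) := WideSubcategory FdHilb.isometries.{u}

/-- Finite-dimensional Hilbert spaces and unitaries. -/
abbrev FdUnitary : Type (u + 1) := WideSubcategory FdHilb.unitaries.{u}

/-- The execution formula in `FdContraction`: sums of families of contractions are taken in
`FdHilb`, and are defined in `FdContraction` when the result is a contraction. -/
noncomputable def FdContraction.ex {A B U : FdContraction.{u}} (f : A ⊗ U ⟶ B ⊗ U) :
    Part (A ⟶ B) :=
  restrictPart (wideSubcategoryInclusion FdHilb.contractions)
    (FdHilb.ex (A := A.obj) (B := B.obj) (U := U.obj) f.hom)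

/-- The inclusion functor `FdIsometry ↪ FdContraction`. -/
abbrev FdIsometry.toFdContraction : FdIsometry.{u} ⥤ FdContraction.{u} :=
  wideInclusionOfLE FdHilb.isometries_le_contractions

/-- The inclusion functor `FdUnitary ↪ FdContraction`. -/
abbrev FdUnitary.toFdContraction : FdUnitary.{u} ⥤ FdContraction.{u} :=
  wideInclusionOfLE FdHilb.unitaries_le_contractions

/-- `êx^U(f)` is `ex^U(f)` if this is an isometry, and is undefined otherwise. -/
noncomputable def FdIsometry.exHat {A B U : FdIsometry.{u}} (f : A ⊗ U ⟶ B ⊗ U) : Part (A ⟶ B) :=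
  restrictPart FdIsometry.toFdContraction
    (FdContraction.ex (A := FdIsometry.toFdContraction.obj A)
      (B := FdIsometry.toFdContraction.obj B) (U := FdIsometry.toFdContraction.obj U)
      (FdIsometry.toFdContraction.map f))

/-- `êx^U(f)` is `ex^U(f)` if this is unitary, and is undefined otherwise. -/
noncomputable def FdUnitary.exHat {A B U : FdUnitary.{u}} (f : A ⊗ U ⟶ B ⊗ U) : Part (A ⟶ B) :=
  restrictPart FdUnitary.toFdContraction
    (FdContraction.ex (A := FdUnitary.toFdContraction.obj A)
      (B := FdUnitary.toFdContraction.obj B) (U := FdUnitary.toFdContraction.obj U)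
      (FdUnitary.toFdContraction.map f))

/-!
The trace feeds the `U`-output of `f : A ⊕ U → B ⊕ U` back into its `U`-input. If `f` is a
contraction and `u` is an eigenvector of `f_UU` of unimodular eigenvalue, then `f (0, u) = (0, μ u)`
has the norm of `(0, u)`, so `f` preserves inner products with `(0, u)` and `f_UA` takes values
orthogonal to `u`. On the orthogonal complement of all such `u`, which `f_UU` leaves invariant, the
spectral radius of `f_UU` is less than one. Hence `w = ∑ f_UU ^ n f_UA a` converges, and it solves
`f (a, w) = (b, w)` with `b = ex^U(f) a`. As `f` is a contraction, this equation determines `b`, so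
each trace axiom reduces to exhibiting the feedback `w`. That the trace is again an isometry is
read off from the norms in `f (a, w) = (b, w)`, and for unitaries surjectivity is a dimension count.
-/

/-- The span of the eigenvectors of an operator whose eigenvalues have absolute value one. It is
the part of a contraction that obstructs the summability of its powers. -/
def peripheralSpace {𝕜 E : Type*} [NormedField 𝕜] [SeminormedAddCommGroup E] [NormedSpace 𝕜 E]
    (T : E →L[𝕜] E) : Submodule 𝕜 E :=
  Submodule.span 𝕜 {x | ∃ μ : 𝕜, ‖μ‖ = 1 ∧ T x = μ • x}

theorem mem_peripheralSpace {𝕜 E : Type*} [NormedField 𝕜] [SeminormedAddCommGroup E]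
    [NormedSpace 𝕜 E] {T : E →L[𝕜] E} {μ : 𝕜} {x : E} (hμ : ‖μ‖ = 1) (hx : T x = μ • x) :
    x ∈ peripheralSpace T :=
  Submodule.subset_span ⟨μ, hμ, hx⟩

section Contraction

variable {𝕜 E F : Type*} [RCLike 𝕜] [NormedAddCommGroup E] [InnerProductSpace 𝕜 E]
  [NormedAddCommGroup F] [InnerProductSpace 𝕜 F]

theorem inner_map_map_of_norm_map_eq [CompleteSpace E] [CompleteSpace F] {T : E →L[𝕜] F}
    (hT : ∀ x, ‖T x‖ ≤ ‖x‖) {x : E} (hx : ‖T x‖ = ‖x‖) (y : E) :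
    inner 𝕜 (T x) (T y) = inner 𝕜 x y := by
  have norm_adjoint_le : ‖T.adjoint (T x)‖ ≤ ‖x‖ := by
    have opNorm_adjoint_le : ‖T.adjoint‖ ≤ 1 := by
      rw [LinearIsometryEquiv.norm_map]
      exact T.opNorm_le_bound zero_le_one (by simpa only [one_mul] using hT)
    exact hx ▸ T.adjoint.le_of_opNorm_le_of_le opNorm_adjoint_le le_rfl |>.trans_eq (one_mul _)
  have adjoint_map_eq : T.adjoint (T x) = x := by
    refine eq_of_norm_le_re_inner_eq_norm_sq (𝕜 := 𝕜) norm_adjoint_le ?_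
    rw [ContinuousLinearMap.adjoint_inner_left, inner_self_eq_norm_sq, hx]
  rw [← ContinuousLinearMap.adjoint_inner_left, adjoint_map_eq]

theorem mem_peripheralSpace_orthogonal_iff {T : E →L[𝕜] E} {y : E} :
    y ∈ (peripheralSpace T)ᗮ ↔
      ∀ (μ : 𝕜) (x : E), ‖μ‖ = 1 → T x = μ • x → inner 𝕜 x y = 0 := by
  rw [← Submodule.span_singleton_le_iff_mem, ← Submodule.isOrtho_iff_le, Submodule.isOrtho_comm,
    peripheralSpace, Submodule.isOrtho_span]
  simp only [Set.mem_ofPred_eq, Set.mem_singleton_iff, forall_eq, forall_exists_index, and_imp]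
  exact forall_comm

theorem map_mem_peripheralSpace_orthogonal [CompleteSpace E] {T : E →L[𝕜] E}
    (hT : ∀ x, ‖T x‖ ≤ ‖x‖) {y : E} (hy : y ∈ (peripheralSpace T)ᗮ) :
    T y ∈ (peripheralSpace T)ᗮ := by
  refine mem_peripheralSpace_orthogonal_iff.2 fun μ x hμ hx => ?_
  have norm_map_x : ‖T x‖ = ‖x‖ := by rw [hx, norm_smul, hμ, one_mul]
  have inner_smul_eq_zero : inner 𝕜 (μ • x) (T y) = 0 := by
    rw [← hx, inner_map_map_of_norm_map_eq hT norm_map_x]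
    exact mem_peripheralSpace_orthogonal_iff.1 hy μ x hμ hx
  have hμ0 : μ ≠ 0 := norm_ne_zero_iff.1 (hμ ▸ one_ne_zero)
  simpa [inner_smul_left, hμ0] using inner_smul_eq_zero

end Contraction

section SummablePowers

theorem summable_norm_pow_of_spectralRadius_lt_one {R : Type*} [NormedRing R] [NormedAlgebra ℂ R]
    [CompleteSpace R] {a : R} (ha : spectralRadius ℂ a < 1) : Summable fun n : ℕ => ‖a ^ n‖ := by
  obtain ⟨r, har, hr⟩ := ENNReal.lt_iff_exists_nnreal_btwn.1 ha
  have hr1 : (r : ℝ) < 1 := by exact_mod_cast hr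
  refine (summable_geometric_of_lt_one r.2 hr1).of_norm_bounded_eventually_nat ?_
  have gelfand := spectrum.pow_norm_pow_one_div_tendsto_nhds_spectralRadius a
  filter_upwards [gelfand.eventually_lt_const har, Filter.eventually_ne_atTop 0] with n hn hn0
  rw [← ENNReal.ofReal_coe_nnreal, ENNReal.ofReal_lt_ofReal_iff_of_nonneg (by positivity)] at hn
  calc ‖‖a ^ n‖‖ = (‖a ^ n‖ ^ (1 / n : ℝ)) ^ n := by
        rw [norm_norm, one_div, Real.rpow_inv_natCast_pow (norm_nonneg _) hn0]
    _ ≤ (r : ℝ) ^ n := pow_le_pow_left₀ (by positivity) hn.le n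

theorem spectralRadius_lt_one_of_eigenvalue_norm_lt_one {E : Type*} [NormedAddCommGroup E]
    [NormedSpace ℂ E] [FiniteDimensional ℂ E] {T : E →L[ℂ] E}
    (hT : ∀ (μ : ℂ) (x : E), x ≠ 0 → T x = μ • x → ‖μ‖ < 1) : spectralRadius ℂ T < 1 := by
  have : CompleteSpace E := FiniteDimensional.complete ℂ E
  rcases subsingleton_or_nontrivial E with _ | _
  · exact (spectrum.SpectralRadius.of_subsingleton (𝕜 := ℂ) T).trans_lt zero_lt_one
  refine spectrum.spectralRadius_lt_of_forall_lt T (r := 1) fun μ hμ => ?_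
  rw [ContinuousLinearMap.spectrum_eq, ← Module.End.hasEigenvalue_iff_mem_spectrum] at hμ
  obtain ⟨x, hx⟩ := hμ.exists_hasEigenvector
  exact hT μ x hx.2 hx.apply_eq_smul

variable {E : Type*} [NormedAddCommGroup E] [InnerProductSpace ℂ E] [FiniteDimensional ℂ E]
  {T : E →L[ℂ] E}

theorem spectralRadius_comp_starProjection_lt_one (hT : ∀ x, ‖T x‖ ≤ ‖x‖) :
    spectralRadius ℂ (T ∘L (peripheralSpace T)ᗮ.starProjection) < 1 := by
  have : CompleteSpace E := FiniteDimensional.complete ℂ E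
  refine spectralRadius_lt_one_of_eigenvalue_norm_lt_one fun μ x hx0 hx => ?_
  by_contra! one_le_norm
  have hμ0 : μ ≠ 0 := norm_pos_iff.1 (zero_lt_one.trans_le one_le_norm)
  have x_mem : x ∈ (peripheralSpace T)ᗮ := by
    rw [← inv_smul_smul₀ hμ0 x, ← hx]
    exact Submodule.smul_mem _ _
      (map_mem_peripheralSpace_orthogonal hT (Submodule.starProjection_apply_mem _ x))
  have map_x : T x = μ • x := by
    rwa [ContinuousLinearMap.comp_apply, Submodule.starProjection_eq_self_iff.2 x_mem] at hx
  have norm_eq_one : ‖μ‖ = 1 := by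
    refine one_le_norm.antisymm' (le_of_mul_le_mul_right ?_ (norm_pos_iff.2 hx0))
    rw [← norm_smul, ← map_x, one_mul]
    exact hT x
  exact hx0 (inner_self_eq_zero.1 (x_mem x (mem_peripheralSpace norm_eq_one map_x)))

theorem pow_comp_starProjection_apply (hT : ∀ x, ‖T x‖ ≤ ‖x‖) (n : ℕ) {x : E}
    (hx : x ∈ (peripheralSpace T)ᗮ) :
    ((T ∘L (peripheralSpace T)ᗮ.starProjection) ^ n) x = (T ^ n) x := by
  have : CompleteSpace E := FiniteDimensional.complete ℂ E
  induction n generalizing x with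
  | zero => rfl
  | succ n ih =>
    rw [pow_succ, pow_succ, mul_apply_eq_comp, mul_apply_eq_comp,
      ContinuousLinearMap.comp_apply, Submodule.starProjection_eq_self_iff.2 hx]
    exact ih (map_mem_peripheralSpace_orthogonal hT hx)

theorem summable_norm_pow_comp {A : Type*} [NormedAddCommGroup A] [NormedSpace ℂ A]
    (hT : ∀ x, ‖T x‖ ≤ ‖x‖) {c : A →L[ℂ] E} (hc : ∀ a, c a ∈ (peripheralSpace T)ᗮ) :
    Summable fun n : ℕ => ‖(T ^ n) ∘L c‖ := by
  have : CompleteSpace E := FiniteDimensional.complete ℂ E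
  let S := T ∘L (peripheralSpace T)ᗮ.starProjection
  have pow_comp_eq (n : ℕ) : (T ^ n) ∘L c = (S ^ n) ∘L c :=
    ContinuousLinearMap.ext fun a => (pow_comp_starProjection_apply hT n (hc a)).symm
  have summable_pow : Summable fun n : ℕ => ‖S ^ n‖ :=
    summable_norm_pow_of_spectralRadius_lt_one (spectralRadius_comp_starProjection_lt_one hT)
  refine (summable_pow.mul_right ‖c‖).of_nonneg_of_le (fun _ => norm_nonneg _) fun n => ?_
  rw [pow_comp_eq]
  exact ContinuousLinearMap.opNorm_comp_le _ _

theorem add_map_eq_of_hasSum_pow {R M : Type*} [Semiring R] [AddCommMonoid M] [Module R M]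
    [TopologicalSpace M] [ContinuousAdd M] [T2Space M] {T : M →L[R] M} {x w : M}
    (hw : HasSum (fun n : ℕ => (T ^ n) x) w) : x + T w = w := by
  have hTw : HasSum (fun n : ℕ => (T ^ (n + 1)) x) (T w) := by
    simpa only [pow_succ', mul_apply_eq_comp] using T.hasSum hw
  exact (hTw.zero_add (f := fun n => (T ^ n) x)).unique hw

end SummablePowers

namespace FdHilb

section Pair

variable {A B : FdHilb.{u}}

/-- The element `(a, b)` of `A ⊕ B`. -/
def pair (a : A) (b : B) : (A ⊗ B : FdHilb.{u}) :=
  (WithLp.toLp 2 (a, b) : dsum A B)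

theorem exists_eq_pair (x : (A ⊗ B : FdHilb.{u})) : ∃ a b, x = pair a b :=
  ⟨WithLp.fst (show dsum A B from x), WithLp.snd (show dsum A B from x), rfl⟩

theorem pair_add_pair (a a' : A) (b b' : B) :
    pair a b + pair a' b' = pair (a + a') (b + b') := rfl

theorem pair_sub_pair (a a' : A) (b b' : B) :
    pair a b - pair a' b' = pair (a - a') (b - b') := rfl

theorem norm_sq_pair (a : A) (b : B) : ‖pair a b‖ ^ 2 = ‖a‖ ^ 2 + ‖b‖ ^ 2 :=
  norm_sq_dsum (A := A) (B := B) _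

theorem inner_pair_pair (a a' : A) (b b' : B) :
    inner ℂ (pair a b) (pair a' b') = inner ℂ a a' + inner ℂ b b' :=
  WithLp.prod_inner_apply (𝕜 := ℂ) (E := A) (F := B) _ _

theorem norm_pair_zero_left (b : B) : ‖(pair 0 b : (A ⊗ B : FdHilb.{u}))‖ = ‖b‖ := by
  rw [← sq_eq_sq₀ (norm_nonneg _) (norm_nonneg _), norm_sq_pair, norm_zero]
  ring

end Pair

section Blocks

variable {A B U : FdHilb.{u}}

/-- The component `f_BA` of `f : A ⊕ U → B ⊕ U`. -/
noncomputable def blockBA (f : A ⊗ U ⟶ B ⊗ U) : A →L[ℂ] B := (inl A U ≫ f ≫ fst B U).toCLM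

/-- The component `f_BU` of `f : A ⊕ U → B ⊕ U`. -/
noncomputable def blockBU (f : A ⊗ U ⟶ B ⊗ U) : U →L[ℂ] B := (inr A U ≫ f ≫ fst B U).toCLM

/-- The component `f_UA` of `f : A ⊕ U → B ⊕ U`. -/
noncomputable def blockUA (f : A ⊗ U ⟶ B ⊗ U) : A →L[ℂ] U := (inl A U ≫ f ≫ snd B U).toCLM

/-- The component `f_UU` of `f : A ⊕ U → B ⊕ U`. -/
noncomputable def blockUU (f : A ⊗ U ⟶ B ⊗ U) : U →L[ℂ] U := (inr A U ≫ f ≫ snd B U).toCLM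

theorem map_pair_zero_right (f : A ⊗ U ⟶ B ⊗ U) (a : A) :
    f.toCLM (pair a 0) = pair (blockBA f a) (blockUA f a) := rfl

theorem map_pair_zero_left (f : A ⊗ U ⟶ B ⊗ U) (w : U) :
    f.toCLM (pair 0 w) = pair (blockBU f w) (blockUU f w) := rfl

theorem map_pair (f : A ⊗ U ⟶ B ⊗ U) (a : A) (w : U) :
    f.toCLM (pair a w) = pair (blockBA f a + blockBU f w) (blockUA f a + blockUU f w) := by
  rw [← pair_add_pair, ← map_pair_zero_right, ← map_pair_zero_left, ← map_add, pair_add_pair,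
    add_zero, zero_add]

theorem norm_sq_blockBU_add_norm_sq_blockUU_le {f : A ⊗ U ⟶ B ⊗ U} (hf : contractions f) (u : U) :
    ‖blockBU f u‖ ^ 2 + ‖blockUU f u‖ ^ 2 ≤ ‖u‖ ^ 2 := by
  rw [← norm_sq_pair, ← map_pair_zero_left, ← norm_pair_zero_left (A := A) u]
  exact pow_le_pow_left₀ (norm_nonneg _) (hf _) 2

theorem norm_blockUU_apply_le {f : A ⊗ U ⟶ B ⊗ U} (hf : contractions f) (u : U) :
    ‖blockUU f u‖ ≤ ‖u‖ :=
  le_of_sq_le_sq (le_of_add_le_of_nonneg_right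
    (norm_sq_blockBU_add_norm_sq_blockUU_le hf u) (sq_nonneg _)) (norm_nonneg _)

theorem blockUA_apply_mem_peripheralSpace_orthogonal {f : A ⊗ U ⟶ B ⊗ U} (hf : contractions f)
    (a : A) : blockUA f a ∈ (peripheralSpace (blockUU f))ᗮ := by
  refine mem_peripheralSpace_orthogonal_iff.2 fun μ u hμ hu => ?_
  have norm_UU : ‖blockUU f u‖ = ‖u‖ := by rw [hu, norm_smul, hμ, one_mul]
  have BU_eq_zero : blockBU f u = 0 := by
    have h := norm_sq_blockBU_add_norm_sq_blockUU_le hf u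
    rw [norm_UU, add_le_iff_nonpos_left] at h
    simpa using h.antisymm (sq_nonneg _)
  have map_u : f.toCLM (pair 0 u) = pair 0 (μ • u) := by rw [map_pair_zero_left, BU_eq_zero, hu]
  have norm_map_u : ‖f.toCLM (pair 0 u)‖ = ‖(pair 0 u : (A ⊗ U : FdHilb.{u}))‖ := by
    rw [map_u, norm_pair_zero_left, norm_pair_zero_left, ← hu, norm_UU]
  have : CompleteSpace (A ⊗ U : FdHilb.{u}) := FiniteDimensional.complete ℂ _
  have : CompleteSpace (B ⊗ U : FdHilb.{u}) := FiniteDimensional.complete ℂ _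
  have inner_eq_zero : inner ℂ (μ • u) (blockUA f a) = 0 := by
    have h := inner_map_map_of_norm_map_eq hf norm_map_u (pair a 0)
    simpa only [map_u, map_pair_zero_right, inner_pair_pair, inner_zero_left, inner_zero_right,
      zero_add, add_zero] using h
  have hμ0 : μ ≠ 0 := norm_ne_zero_iff.1 (hμ ▸ one_ne_zero)
  simpa [inner_smul_left, hμ0] using inner_eq_zero

end Blocks

section Ex

variable {A B U : FdHilb.{u}} {f : A ⊗ U ⟶ B ⊗ U}

theorem summable_norm_blockUU_pow_comp_blockUA (hf : contractions f) :
    Summable fun n : ℕ => ‖(blockUU f ^ n) ∘L blockUA f‖ :=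
  summable_norm_pow_comp (norm_blockUU_apply_le hf)
    (blockUA_apply_mem_peripheralSpace_orthogonal hf)

theorem summable_paths (hf : contractions f) : Summable (paths f) := by
  have : CompleteSpace B := FiniteDimensional.complete ℂ B
  refine Summable.sum _ (hasSum_fintype _).summable ?_
  exact .of_norm_bounded ((summable_norm_blockUU_pow_comp_blockUA hf).mul_left ‖blockBU f‖)
    fun n => ContinuousLinearMap.opNorm_comp_le _ _

theorem mem_ex_iff {g : A ⟶ B} : g ∈ ex f ↔ HasSum (paths f) g.toCLM := by
  constructor
  · rintro ⟨h, rfl⟩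
    exact h.hasSum
  · exact fun h => ⟨h.summable, Hom.ext h.tsum_eq⟩

/-- `f : A ⊕ U → B ⊕ U` sends `(a, w)` to `(b, w)` for some `w`, that is, `b` is an output of `f` at
the input `a` when its output in `U` is fed back into its input in `U`. This is the trace of the
graph of `f` in the category of relations. -/
def FeedsBack (f : A ⊗ U ⟶ B ⊗ U) (a : A) (b : B) : Prop :=
  ∃ w : U, f.toCLM (pair a w) = pair b w

theorem feedsBack_of_mem_ex (hf : contractions f) {g : A ⟶ B} (hg : g ∈ ex f) (a : A) :
    FeedsBack f a (g.toCLM a) := by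
  have : CompleteSpace U := FiniteDimensional.complete ℂ U
  have summable_loops : Summable fun n : ℕ => (blockUU f ^ n) ∘L blockUA f :=
    (summable_norm_blockUU_pow_comp_blockUA hf).of_norm
  have summable_loops_apply : Summable fun n : ℕ => (blockUU f ^ n) (blockUA f a) := by
    simpa only [ContinuousLinearMap.apply_apply, ContinuousLinearMap.comp_apply] using
      (ContinuousLinearMap.apply ℂ U a).summable summable_loops
  obtain ⟨w, hw⟩ := summable_loops_apply
  have hasSum_paths_apply : HasSum (fun i => paths f i a) (blockBA f a + blockBU f w) :=
    .sum (hasSum_unique _) ((blockBU f).hasSum hw)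
  have hasSum_apply : HasSum (fun i => paths f i a) (g.toCLM a) :=
    (ContinuousLinearMap.apply ℂ B a).hasSum (mem_ex_iff.1 hg)
  have apply_eq : g.toCLM a = blockBA f a + blockBU f w := hasSum_apply.unique hasSum_paths_apply
  exact ⟨w, by rw [map_pair, add_map_eq_of_hasSum_pow hw, apply_eq]⟩

end Ex

namespace FeedsBack

variable {A B U : FdHilb.{u}} {f : A ⊗ U ⟶ B ⊗ U} {a : A} {b : B}

theorem unique (hf : contractions f) {b' : B} (h : FeedsBack f a b) (h' : FeedsBack f a b') :
    b = b' := by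
  obtain ⟨w, hw⟩ := h
  obtain ⟨w', hw'⟩ := h'
  have norm_sq_le := pow_le_pow_left₀ (norm_nonneg _) (hf (pair a w - pair a w')) 2
  rw [map_sub, hw, hw', pair_sub_pair, pair_sub_pair, norm_sq_pair, norm_sq_pair, sub_self,
    norm_zero, zero_pow two_ne_zero, zero_add, add_le_iff_nonpos_left] at norm_sq_le
  exact sub_eq_zero.1 (by simpa using norm_sq_le.antisymm (sq_nonneg _))

theorem norm_eq (hf : isometries f) (h : FeedsBack f a b) : ‖b‖ = ‖a‖ := by
  obtain ⟨w, hw⟩ := h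
  have norm_sq_eq := congrArg (‖·‖ ^ 2) hw
  simp only [hf _, norm_sq_pair, add_left_inj] at norm_sq_eq
  exact ((sq_eq_sq₀ (norm_nonneg _) (norm_nonneg _)).1 norm_sq_eq).symm

theorem comp {A' B' : FdHilb.{u}} (g : A' ⟶ A) (h : B ⟶ B') {a : A'}
    (hab : FeedsBack f (g.toCLM a) b) :
    FeedsBack ((g ⊗ₘ 𝟙 U) ≫ f ≫ (h ⊗ₘ 𝟙 U)) a (h.toCLM b) := by
  obtain ⟨w, hw⟩ := hab
  exact ⟨w, congrArg (h ⊗ₘ 𝟙 U).toCLM hw⟩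

theorem slide {U' : FdHilb.{u}} {f : A ⊗ U ⟶ B ⊗ U'} {g : U' ⟶ U}
    (h : FeedsBack ((𝟙 A ⊗ₘ g) ≫ f) a b) : FeedsBack (f ≫ (𝟙 B ⊗ₘ g)) a b := by
  obtain ⟨w, hw⟩ := h
  exact ⟨g.toCLM w, congrArg (𝟙 B ⊗ₘ g).toCLM hw⟩

theorem superpose {C D : FdHilb.{u}} (g : C ⟶ D) (c : C) (h : FeedsBack f a b) :
    FeedsBack ((α_ C A U).hom ≫ (g ⊗ₘ f) ≫ (α_ D B U).inv) (pair c a) (pair (g.toCLM c) b) := by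
  obtain ⟨w, hw⟩ := h
  exact ⟨w, congrArg (fun y => (α_ D B U).inv.toCLM (pair (g.toCLM c) y)) hw⟩

theorem exists_curry {V : FdHilb.{u}} {f : A ⊗ (U ⊗ V) ⟶ B ⊗ (U ⊗ V)} (h : FeedsBack f a b) :
    ∃ u : U, FeedsBack ((α_ A U V).hom ≫ f ≫ (α_ B U V).inv) (pair a u) (pair b u) := by
  obtain ⟨x, hx⟩ := h
  obtain ⟨u, v, rfl⟩ := exists_eq_pair x
  exact ⟨u, v, congrArg (α_ B U V).inv.toCLM hx⟩

theorem of_unit (f : A ⊗ 𝟙_ FdHilb.{u} ⟶ B ⊗ 𝟙_ FdHilb.{u}) (a : A) :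
    FeedsBack f a (((ρ_ A).inv ≫ f ≫ (ρ_ B).hom).toCLM a) :=
  ⟨PUnit.unit, rfl⟩

theorem braiding (a : A) : FeedsBack (β_ A A).hom a a := ⟨a, rfl⟩

end FeedsBack

theorem isometries_of_mem_ex {A B U : FdHilb.{u}} {f : A ⊗ U ⟶ B ⊗ U} (hf : isometries f)
    {g : A ⟶ B} (hg : g ∈ ex f) : isometries g := fun a =>
  (feedsBack_of_mem_ex (isometries_le_contractions _ hf) hg a).norm_eq hf

theorem isometries.injective {A B : FdHilb.{u}} {f : A ⟶ B} (hf : isometries f) :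
    Function.Injective f.toCLM :=
  (AddMonoidHomClass.isometry_of_norm f.toCLM hf).injective

theorem finrank_eq_of_unitaries {A B : FdHilb.{u}} {f : A ⟶ B} (hf : unitaries f) :
    Module.finrank ℂ A = Module.finrank ℂ B :=
  (LinearEquiv.ofBijective f.toCLM.toLinearMap ⟨isometries.injective hf.1, hf.2⟩).finrank_eq

theorem finrank_tensorObj (A B : FdHilb.{u}) :
    Module.finrank ℂ (A ⊗ B : FdHilb.{u}) = Module.finrank ℂ A + Module.finrank ℂ B :=
  (WithLp.linearEquiv 2 ℂ (A × B)).finrank_eq.trans Module.finrank_prod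

theorem unitaries_of_mem_ex {A B U : FdHilb.{u}} {f : A ⊗ U ⟶ B ⊗ U} (hf : unitaries f)
    {g : A ⟶ B} (hg : g ∈ ex f) : unitaries g := by
  have isometry_g : isometries g := isometries_of_mem_ex hf.1 hg
  have finrank_eq : Module.finrank ℂ A = Module.finrank ℂ B := by
    simpa only [finrank_tensorObj, add_left_inj] using finrank_eq_of_unitaries hf
  exact ⟨isometry_g, (LinearMap.injective_iff_surjective_of_finrank_eq_finrank
    (f := g.toCLM.toLinearMap) finrank_eq).1 (isometries.injective isometry_g)⟩

section WideSubcategory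

variable {P : MorphismProperty FdHilb.{u}} [P.IsStableUnderBraiding] (hP : P ≤ contractions)
  (hex : ∀ {A B U : FdHilb.{u}} {f : A ⊗ U ⟶ B ⊗ U} {g : A ⟶ B}, P f → g ∈ ex f → P g)

/-- The trace on a symmetric monoidal category of contractions that is closed under the execution
formula. -/
noncomputable def trace {A B U : WideSubcategory P} (f : A ⊗ U ⟶ B ⊗ U) : A ⟶ B :=
  let f' : A.obj ⊗ U.obj ⟶ B.obj ⊗ U.obj := f.hom
  ⟨(ex f').get (summable_paths (hP _ f.property)), hex f.property (Part.get_mem _)⟩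

theorem trace_hom_mem_ex {A B U : WideSubcategory P} (f : A ⊗ U ⟶ B ⊗ U) :
    (trace hP hex f).hom ∈ ex (A := A.obj) (B := B.obj) (U := U.obj) f.hom :=
  Part.get_mem (summable_paths (hP _ f.property))

theorem feedsBack_trace {A B U : WideSubcategory P} (f : A ⊗ U ⟶ B ⊗ U) (a : A.obj) :
    FeedsBack (U := U.obj) f.hom a ((trace hP hex f).hom.toCLM a) :=
  feedsBack_of_mem_ex (hP _ f.property) (trace_hom_mem_ex hP hex f) a

theorem trace_eq_of_feedsBack {A B U : WideSubcategory P} {f : A ⊗ U ⟶ B ⊗ U} {g : A ⟶ B}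
    (h : ∀ a : A.obj, FeedsBack (U := U.obj) f.hom a (g.hom.toCLM a)) : trace hP hex f = g :=
  WideSubcategory.hom_ext P <| hom_ext fun a =>
    (feedsBack_trace hP hex f a).unique (hP _ f.property) (h a)

theorem isTrace_trace : IsTrace (C := WideSubcategory P) (trace hP hex) where
  naturality f g h := (trace_eq_of_feedsBack hP hex fun a =>
    (feedsBack_trace hP hex f (g.hom.toCLM a)).comp g.hom h.hom).symm
  dinaturality f g := trace_eq_of_feedsBack hP hex fun a =>
    (feedsBack_trace hP hex ((𝟙 _ ⊗ₘ g) ≫ f) a).slide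
  superposing f g := (trace_eq_of_feedsBack hP hex fun x => by
    obtain ⟨c, a, rfl⟩ := exists_eq_pair x
    exact (feedsBack_trace hP hex f a).superpose g.hom c).symm
  vanishing_one f := trace_eq_of_feedsBack hP hex (FeedsBack.of_unit f.hom)
  vanishing_two {A B U V} f := trace_eq_of_feedsBack hP hex fun a => by
    obtain ⟨u, hu⟩ := (feedsBack_trace hP hex f a).exists_curry
    let f' := (α_ A U V).hom ≫ f ≫ (α_ B U V).inv
    exact ⟨u, (feedsBack_trace hP hex f' (pair a u)).unique (hP _ f'.property) hu⟩
  yanking U := trace_eq_of_feedsBack hP hex FeedsBack.braiding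

end WideSubcategory

end FdHilb

theorem mainTheorem3_general {P : MorphismProperty FdHilb.{u}} [P.IsStableUnderBraiding]
    (hP : P ≤ FdHilb.contractions)
    (hex : ∀ {A B U : FdHilb.{u}} {f : A ⊗ U ⟶ B ⊗ U} {g : A ⟶ B},
      P f → g ∈ FdHilb.ex f → P g) :
    IsTotallyTraced (WideSubcategory P) fun {A B U} f =>
      restrictPart (wideInclusionOfLE hP)
        (FdContraction.ex (A := (wideInclusionOfLE hP).obj A)
          (B := (wideInclusionOfLE hP).obj B) (U := (wideInclusionOfLE hP).obj U)
          ((wideInclusionOfLE hP).map f)) := by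
  refine ⟨FdHilb.trace hP hex, FdHilb.isTrace_trace hP hex, fun f => Part.eq_some_iff.2 ?_⟩
  exact (mem_restrictPart _ _ _).2 ((mem_restrictPart _ _ _).2 (FdHilb.trace_hom_mem_ex hP hex f))

theorem mainTheorem3 :
    IsTotallyTraced FdIsometry.{u} FdIsometry.exHat ∧
      IsTotallyTraced FdUnitary.{u} FdUnitary.exHat :=
  ⟨mainTheorem3_general FdHilb.isometries_le_contractions fun hf => FdHilb.isometries_of_mem_ex hf,
    mainTheorem3_general FdHilb.unitaries_le_contractions fun hf => FdHilb.unitaries_of_mem_ex hf⟩
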